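/- For a digraph $D$, the distinguishing index $D'(D)$ is the least number of colours in a (not necessarily proper) colouring of the arcs of $D$ such that the identity is the only automorphism of $D$ (permutation of the vertices preserving the arcs and their directions) that preserves the colouring. For a graph $G$, an orientation of $G$ is a digraph obtained by replacing each edge $xy$ of $G$ by exactly one of the arcs $\overrightarrow{xy}$, $\overrightarrow{yx}$, and $OD'^-(G)$ is the minimum of $D'(\overrightarrow{G})$ over all orientations $\overrightarrow{G}$ of $G$. Let $m,n,r$ be integers such that $1\le m\le n$, $r\ge 2$ and $(r-1)^m<n\le r^m$. Then $$OD'^-(K_{m,n})=\begin{cases}\left\lceil \frac r2\right\rceil, & \text{if } n\le r^m-\lceil\log_r m\rceil-1,\\[2pt] \left\lceil \frac{r+1}2\right\rceil, & \text{if } n\ge r^m-\lceil\log_r m\rceil+1.\end{cases}$$ Moreover, if $n=r^m-\lceil\log_r m\rceil$, then $OD'^-(K_{m,n})$ is either $\lceil r/2\rceil$ or $\lceil (r+1)/2\rceil$, and it can be computed from $m,n,r$ in time $O(\log^* n)$, where $\log^* n$ is the number of times the binary logarithm has to be applied to $n$ until the result is at most $1$. Here time is the number of steps on a register machine with unit-cost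 arithmetic: there are one program and one constant $C$ such that for all such $m,n,r$ the program, started with $m,n,r$ in its first three registers, stops after at most $C\log^* n$ steps with $OD'^-(K_{m,n})$ in its first register, and no register ever holds a number greater than $n^C$. One step is either loading a constant, or one of the operations $+$, truncated $-$, $\times$, integer division, exponentiation on nonnegative integers held in registers, or a jump conditional on a comparison of two registers. -/

import Mathlib

namespace OrientedIndex

/-- `D` is an orientation of `G`: every edge `uv` of `G` is replaced by exactly one of the arcs
`(u, v)`, `(v, u)`, and `D` has no other arcs. -/
def IsOrientation {V : Type*} (G : SimpleGraph V) (D : Digraph V) : Prop :=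
  (∀ u v, G.Adj u v ↔ D.Adj u v ∨ D.Adj v u) ∧ ∀ u v, D.Adj u v → ¬ D.Adj v u

/-- The set of arcs of a digraph. -/
abbrev Arc {V : Type*} (D : Digraph V) : Type _ := {p : V × V // D.Adj p.1 p.2}

/-- An automorphism of a digraph: a permutation of the vertices that preserves the arcs together
with their direction. -/
abbrev Aut {V : Type*} (D : Digraph V) : Type _ := D.Adj ≃r D.Adj

/-- The action of an automorphism on the arcs. -/
def Aut.onArc {V : Type*} {D : Digraph V} (φ : Aut D) (a : Arc D) : Arc D :=
  ⟨(φ a.1.1, φ a.1.2), φ.map_rel_iff.2 a.2⟩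

/-- An arc colouring is distinguishing if the identity is the only automorphism preserving it. -/
def IsDistinguishing {V : Type*} (D : Digraph V) {k : ℕ} (c : Arc D → Fin k) : Prop :=
  ∀ φ : Aut D, (∀ a : Arc D, c (φ.onArc a) = c a) → ∀ v, φ v = v

/-- The distinguishing index of a digraph: the least number of colours in a distinguishing arc
colouring (`⊤` if there is no such colouring). -/
noncomputable def distIndex {V : Type*} (D : Digraph V) : ℕ∞ :=
  ⨅ (k : ℕ) (_ : ∃ c : Arc D → Fin k, IsDistinguishing D c), (k : ℕ∞)

/-- The minimum of the distinguishing index over all orientations of `G`. -/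
noncomputable def minOrientedIndex {V : Type*} (G : SimpleGraph V) : ℕ∞ :=
  ⨅ (D : Digraph V) (_ : IsOrientation G D), distIndex D

/-- The iterated logarithm `log* n`: the number of times the binary logarithm has to be applied
to `n` until the result is at most `1`. -/
noncomputable def logStar (n : ℕ) : ℕ :=
  sInf {k : ℕ | (Real.logb 2)^[k] (n : ℝ) ≤ 1}

/-! A register machine over the natural numbers with unit-cost arithmetic. -/

/-- The arithmetic operations of the machine. -/
inductive Op where
  | add | sub | mul | div | pow

/-- Subtraction is truncated at `0`, division is rounded down. -/
def Op.eval : Op → ℕ → ℕ → ℕ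
  | .add, a, b => a + b
  | .sub, a, b => a - b
  | .mul, a, b => a * b
  | .div, a, b => a / b
  | .pow, a, b => a ^ b

/-- Instructions; `x`, `y`, `z` are register addresses:
* `const x c`: put the constant `c` into register `x`;
* `arith o z x y`: put `o (reg x) (reg y)` into register `z`;
* `jle x y l`: if `reg x ≤ reg y`, continue with instruction number `l`. -/
inductive Instr where
  | const (x c : ℕ)
  | arith (o : Op) (z x y : ℕ)
  | jle (x y l : ℕ)

/-- A configuration: the number of the next instruction and the contents of the registers. -/
structure Config where
  pc : ℕ
  reg : ℕ → ℕ

/-- Execution of one instruction. The machine has halted, and its configuration does not change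
any more, when there is no instruction with number `pc`. -/
def step (P : List Instr) (s : Config) : Config :=
  match P[s.pc]? with
  | none => s
  | some (.const x c) => ⟨s.pc + 1, Function.update s.reg x c⟩
  | some (.arith o z x y) =>
      ⟨s.pc + 1, Function.update s.reg z (o.eval (s.reg x) (s.reg y))⟩
  | some (.jle x y l) => ⟨if s.reg x ≤ s.reg y then l else s.pc + 1, s.reg⟩

/-- The initial configuration: `a`, `b`, `c` in the registers `0`, `1`, `2`, all others `0`. -/
def initial (a b c : ℕ) : Config where
  pc := 0
  reg
    | 0 => a
    | 1 => b
    | 2 => c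
    | _ => 0

/-- The configuration after `t` steps on input `(a, b, c)`. -/
def run (P : List Instr) (a b c t : ℕ) : Config := (step P)^[t] (initial a b c)

/-- On input `(a, b, c)` the program `P` halts after at most `T` steps with `v` in register `0`,
and no register ever holds a number greater than `B`. -/
def ComputesWithin (P : List Instr) (a b c v T B : ℕ) : Prop :=
  (∃ t ≤ T, P.length ≤ (run P a b c t).pc ∧ (run P a b c t).reg 0 = v) ∧
    ∀ t i, (run P a b c t).reg i ≤ B

end OrientedIndex

namespace OrientedIndex

open Finset

/-! An orientation of `K_{m,n}` with `k` arc colours is an `m × n` matrix over `2k` symbols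
(direction, colour). Automorphisms fixing both sides are pairs of row and column permutations, so
apart from side swaps the question is whether a rigid matrix exists. Rigidity forces distinct
columns, so it amounts to a set of `n` words of length `m` with no coordinate symmetry: `Asym m (2k)
n`. Side swaps are impossible for `m < n`, and one explicit orientation settles `m = n`.

`Asym` survives transposition (`Asym.symm`) and complementation of the word set (`Asym.compl`). For
even `s` it holds whenever `m ≤ n ≤ s ^ m - m` (`asym_of_le_of_le`). With `N = s ^ m - n`, it is
equivalent to `Asym N s m`; hence `m ≤ s ^ N` is necessary, and `m ≤ s ^ (N - 1)` is sufficient if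
`N > 0` and `m ≤ n`. These bounds differ only at `N = ⌈log_s m⌉`.

Since `(r - 1) ^ m < n`, at least `r` symbols are needed. The index is thus `r / 2` if `r` is even
and `Asym m r n` holds; otherwise `r / 2 + 1` colours provide enough room. In the boundary case the
program iterates `(m, n) ↦ (r ^ m - n, m)`; each undecided pass shrinks the first entry
logarithmically. -/

/-! ### Asymmetric word sets and rigid matrices. -/

/-- There are `n` words of length `m` over `s` letters such that no nontrivial permutation of the
coordinates preserves the set of these words. -/
def Asym (m s n : ℕ) : Prop :=
  ∃ X : Finset (Fin m → Fin s), X.card = n ∧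
    ∀ σ : Equiv.Perm (Fin m), (∀ w, w ∘ σ ∈ X ↔ w ∈ X) → σ = 1

/-- No nontrivial permutation of the rows and columns preserves the matrix. -/
def RigidMatrix {α β γ : Type*} (M : α → β → γ) : Prop :=
  ∀ (σ : Equiv.Perm α) (τ : Equiv.Perm β), (∀ i j, M (σ i) (τ j) = M i j) → σ = 1 ∧ τ = 1

theorem RigidMatrix.transpose {α β γ : Type*} {M : α → β → γ} (h : RigidMatrix M) :
    RigidMatrix fun j i => M i j :=
  fun σ τ hM => (h τ σ fun i j => hM j i).symm

theorem RigidMatrix.comp_injective {α β γ δ : Type*} {M : α → β → γ} (h : RigidMatrix M)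
    {f : γ → δ} (hf : f.Injective) : RigidMatrix fun i j => f (M i j) :=
  fun σ τ hM => h σ τ fun i j => hf (hM i j)

/-- Equal columns could be swapped, so the columns form a set of `n` words; a row permutation
preserving this set induces a column permutation. -/
theorem RigidMatrix.asym {m n s : ℕ} {M : Fin m → Fin n → Fin s} (h : RigidMatrix M) :
    Asym m s n := by
  have hinj : Function.Injective fun (j : Fin n) (i : Fin m) => M i j := by
    intro j j' hjj
    have hcol : ∀ i, M i j = M i j' := fun i => congrFun hjj i
    have := (h 1 (Equiv.swap j j') fun i x => by
      rcases eq_or_ne x j with rfl | hx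
      · simp [hcol]
      · rcases eq_or_ne x j' with rfl | hx'
        · simp [hcol]
        · simp [Equiv.swap_apply_of_ne_of_ne hx hx']).2
    have := congrArg (fun e : Equiv.Perm (Fin n) => e j) this
    simpa using this.symm
  refine ⟨univ.image fun (j : Fin n) (i : Fin m) => M i j, ?_, fun σ hσ => ?_⟩
  · rw [card_image_of_injective _ hinj, card_univ, Fintype.card_fin]
  · have hex : ∀ j, ∃ j', ∀ i, M i j' = M (σ i) j := by
      intro j
      have := (hσ fun i => M i j).2 (mem_image_of_mem _ (mem_univ j))
      obtain ⟨j', -, hj'⟩ := mem_image.1 this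
      exact ⟨j', fun i => congrFun hj' i⟩
    choose τ hτ using hex
    have hτi : Function.Injective τ := by
      intro j j' hjj
      apply hinj
      funext i
      have h1 := hτ j (σ.symm i)
      have h2 := hτ j' (σ.symm i)
      rw [hjj] at h1
      simpa using h1.symm.trans h2
    let e : Equiv.Perm (Fin n) := Equiv.ofBijective τ (Finite.injective_iff_bijective.1 hτi)
    have he : ∀ j, e j = τ j := fun j => rfl
    have := (h σ e.symm fun i j => by
      rw [← hτ, ← he, Equiv.apply_symm_apply]).1
    exact this

theorem Asym.exists_rigidMatrix {m n s : ℕ} (h : Asym m s n) :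
    ∃ M : Fin m → Fin n → Fin s, RigidMatrix M := by
  obtain ⟨X, hX, h⟩ := h
  let e : Fin n ≃ X := (X.equivFinOfCardEq hX).symm
  refine ⟨fun i j => (e j).1 i, fun σ τ hM => ?_⟩
  have hM' : ∀ j, (e (τ j)).1 ∘ σ = (e j).1 := fun j => funext fun i => hM i j
  have hσ : σ = 1 := by
    refine h σ fun w => ⟨fun hw => ?_, fun hw => ?_⟩
    · have h1 := hM' (e.symm ⟨_, hw⟩)
      rw [Equiv.apply_symm_apply] at h1
      have : (e (τ (e.symm ⟨_, hw⟩))).1 = w := σ.surjective.injective_comp_right h1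
      rw [← this]
      exact (e _).2
    · have h1 := hM' (τ.symm (e.symm ⟨w, hw⟩))
      rw [Equiv.apply_symm_apply, Equiv.apply_symm_apply] at h1
      rw [h1]
      exact (e _).2
  refine ⟨hσ, Equiv.ext fun j => e.injective (Subtype.ext ?_)⟩
  simpa [hσ] using hM' j

theorem Asym.symm {m n s : ℕ} (h : Asym m s n) : Asym n s m := by
  obtain ⟨M, hM⟩ := h.exists_rigidMatrix
  exact hM.transpose.asym

theorem Asym.le_pow {m n s : ℕ} (h : Asym m s n) : n ≤ s ^ m := by
  obtain ⟨X, rfl, -⟩ := h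
  simpa using X.card_le_univ

theorem Asym.compl {m n s : ℕ} (h : Asym m s n) : Asym m s (s ^ m - n) := by
  obtain ⟨X, rfl, h⟩ := h
  refine ⟨Xᶜ, by simp [card_compl], fun σ hσ => h σ fun w => ?_⟩
  have := hσ w
  simp only [mem_compl] at this
  tauto

theorem asym_compl_iff {m n s : ℕ} (h : n ≤ s ^ m) : Asym m s (s ^ m - n) ↔ Asym m s n := by
  refine ⟨fun h' => ?_, Asym.compl⟩
  have := h'.compl
  rwa [Nat.sub_sub_self h] at this

/-- A permutation preserving `X` preserves each coordinate sum, so distinct sums leave only the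
identity. -/
theorem asym_of_injective_sum {m s : ℕ} (X : Finset (Fin m → Fin s))
    (hX : Function.Injective fun i => ∑ w ∈ X, (w i : ℕ)) : Asym m s X.card := by
  refine ⟨X, rfl, fun σ hσ => Equiv.ext fun i => hX ?_⟩
  refine Finset.sum_bij (fun w _ => w ∘ σ) (fun w hw => (hσ w).2 hw)
    (fun w _ w' _ hww => σ.surjective.injective_comp_right hww)
    (fun w hw => ⟨w ∘ σ.symm, (hσ _).1 ?_, ?_⟩) (fun w _ => rfl)
  · simpa [Function.comp_assoc] using hw
  · simp [Function.comp_assoc]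

/-! ### Word sets with distinct coordinate sums. -/

section Construction

variable {m s : ℕ}

/-- The words whose first letters are maximal and whose other letters are `0`. -/
def stairWord (hs : 0 < s) (j : Fin m) : Fin m → Fin s :=
  fun i => if i ≤ j then ⟨s - 1, by omega⟩ else ⟨0, hs⟩

/-- The word with every letter reversed. -/
def revWord (w : Fin m → Fin s) : Fin m → Fin s := fun i => (w i).rev

theorem revWord_revWord (w : Fin m → Fin s) : revWord (revWord w) = w := by
  funext i
  simp [revWord]

theorem revWord_injective : Function.Injective (revWord : (Fin m → Fin s) → _) :=
  Function.LeftInverse.injective revWord_revWord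

theorem revWord_ne (hs : Even s) (hm : 0 < m) (w : Fin m → Fin s) : revWord w ≠ w := by
  intro h
  have := congrArg Fin.val (congrFun h ⟨0, hm⟩)
  simp only [revWord, Fin.val_rev] at this
  obtain ⟨k, rfl⟩ := hs
  omega

theorem stairWord_injective (hs : 2 ≤ s) :
    Function.Injective (stairWord (m := m) (s := s) (by omega)) := by
  intro j j' h
  have h1 := congrArg Fin.val (congrFun h j)
  have h2 := congrArg Fin.val (congrFun h j')
  simp only [stairWord, le_refl, if_true] at h1 h2
  apply le_antisymm
  · by_contra hc
    simp only [hc, if_false] at h1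
    omega
  · by_contra hc
    simp only [hc, if_false] at h2
    omega

theorem stairWord_ne_revWord (hs : 2 ≤ s) (j j' : Fin m) :
    stairWord (s := s) (by omega) j ≠ revWord (stairWord (by omega) j') := by
  intro h
  have h1 := congrArg Fin.val (congrFun h ⟨0, j.pos⟩)
  have e1 : (⟨0, j.pos⟩ : Fin m) ≤ j := Nat.zero_le _
  have e2 : (⟨0, j.pos⟩ : Fin m) ≤ j' := Nat.zero_le _
  simp only [stairWord, revWord, e1, e2, if_true, Fin.val_rev] at h1
  omega

/-- The set of all stair words. -/
def stair (m : ℕ) (hs : 0 < s) : Finset (Fin m → Fin s) := univ.image (stairWord hs)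

theorem card_stair (hs : 2 ≤ s) : (stair (s := s) m (by omega)).card = m := by
  rw [stair, card_image_of_injective _ (stairWord_injective hs), card_univ, Fintype.card_fin]

theorem sum_stair_strictAnti (hs : 2 ≤ s) :
    StrictAnti fun i => ∑ w ∈ stair (s := s) m (by omega), (w i : ℕ) := by
  intro i i' hi
  simp only [stair]
  rw [sum_image (stairWord_injective hs).injOn, sum_image (stairWord_injective hs).injOn]
  refine sum_lt_sum (fun j _ => ?_) ⟨i, mem_univ _, ?_⟩
  · simp only [stairWord]
    split_ifs with h1 h2
    · exact le_rfl
    · exact absurd (hi.le.trans h1) h2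
    · simp
    · simp
  · simp only [stairWord, le_refl, if_true, not_le.2 hi, if_false]
    omega

/-- The stair words have strictly decreasing coordinate sums, and adjoining a pair `w`, `revWord w`
shifts all sums equally. Reversed stair words are kept out so that one of them, the zero word,
remains available for fixing parity. -/
theorem exists_stair_union_pairs (hs : 2 ≤ s) (he : Even s) (hm : 0 < m) (j : ℕ)
    (hj : m + 2 * j + m ≤ s ^ m) :
    ∃ X : Finset (Fin m → Fin s), X.card = m + 2 * j ∧ stair m (by omega) ⊆ X ∧
      (∀ i, revWord (stairWord (by omega) i) ∉ X) ∧
      (∀ w ∉ stair m (by omega), w ∈ X → revWord w ∈ X) ∧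
      StrictAnti fun i => ∑ w ∈ X, (w i : ℕ) := by
  induction j with
  | zero =>
    refine ⟨stair m (by omega), card_stair hs, Subset.rfl, fun i hi => ?_,
      fun w h1 h2 => absurd h2 h1, sum_stair_strictAnti hs⟩
    obtain ⟨j, -, hj⟩ := mem_image.1 hi
    exact stairWord_ne_revWord hs _ _ hj
  | succ j ih =>
    obtain ⟨X, hc, hX, hr, hp, hsum⟩ := ih (by omega)
    obtain ⟨w, hw⟩ : ∃ w, w ∉ X ∪ (stair (s := s) m (by omega)).image revWord := by
      by_contra! hall
      have h1 : (univ : Finset (Fin m → Fin s)).card ≤ _ := card_le_card fun w _ => hall w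
      have h2 := card_union_le X ((stair (s := s) m (by omega)).image revWord)
      rw [card_image_of_injective _ revWord_injective, card_stair hs] at h2
      simp only [card_univ, Fintype.card_fun, Fintype.card_fin] at h1
      omega
    rw [mem_union, not_or] at hw
    obtain ⟨hwX, hwr⟩ := hw
    have hwC : w ∉ stair m (by omega) := fun h => hwX (hX h)
    have hrC : revWord w ∉ stair m (by omega) := fun h =>
      hwr (mem_image.2 ⟨_, h, revWord_revWord w⟩)
    have hrX : revWord w ∉ X := fun h => hwX (by simpa [revWord_revWord] using hp _ hrC h)
    have hne : revWord w ≠ w := revWord_ne he hm w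
    have hrw : revWord w ∉ insert w X := by simp [hne, hrX]
    refine ⟨insert (revWord w) (insert w X), ?_, ?_, ?_, ?_, ?_⟩
    · rw [card_insert_of_notMem hrw, card_insert_of_notMem hwX, hc]
      ring
    · exact hX.trans ((subset_insert _ _).trans (subset_insert _ _))
    · intro i hi
      rcases mem_insert.1 hi with h | h
      · exact hwC (revWord_injective h ▸ mem_image_of_mem _ (mem_univ i))
      · rcases mem_insert.1 h with h | h
        · exact hwr (mem_image.2 ⟨_, mem_image_of_mem _ (mem_univ i), h⟩)
        · exact hr i h
    · intro v hv hvX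
      rcases mem_insert.1 hvX with rfl | h
      · simp [revWord_revWord]
      · rcases mem_insert.1 h with rfl | h
        · simp
        · exact mem_insert_of_mem (mem_insert_of_mem (hp v hv h))
    · intro i i' hi
      -- A word and its reverse together contribute `s - 1` to every coordinate.
      have h1 : ∀ i, ((revWord w i : Fin s) : ℕ) + (w i : ℕ) = s - 1 := by
        intro i
        simp only [revWord, Fin.val_rev]
        omega
      have h2 := hsum hi
      simp only [sum_insert hrw, sum_insert hwX]
      have := h1 i
      have := h1 i'
      simp only at h2
      omega

theorem asym_of_le_of_le {n : ℕ} (hs : 2 ≤ s) (he : Even s) (hm : 0 < m) (h1 : m ≤ n)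
    (h2 : n + m ≤ s ^ m) : Asym m s n := by
  have hp : Even (s ^ m) := he.pow_of_ne_zero hm.ne'
  obtain ⟨K, hK⟩ := hp
  obtain ⟨X, hc, -, hr, -, hsum⟩ :=
    exists_stair_union_pairs hs he hm ((n - m) / 2) (by omega)
  rcases Nat.even_or_odd' (n - m) with ⟨j, hj | hj⟩
  · have := asym_of_injective_sum X hsum.injective
    rwa [hc, show m + 2 * ((n - m) / 2) = n by omega] at this
  -- The last stair word is constantly `s - 1`, so its reverse is the zero word: it adds one element
  -- and leaves all sums unchanged.
  · set z : Fin m → Fin s := revWord (stairWord (by omega) ⟨m - 1, by omega⟩) with hz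
    have hz0 : ∀ i, ((z i : Fin s) : ℕ) = 0 := by
      intro i
      have : i ≤ (⟨m - 1, by omega⟩ : Fin m) := by
        rw [Fin.le_def]
        have := i.2
        simp only
        omega
      simp only [hz, revWord, stairWord, this, if_true, Fin.val_rev]
      omega
    have hzX : z ∉ X := hr _
    have := asym_of_injective_sum (insert z X) (by
      simp only [sum_insert hzX, hz0, zero_add]
      exact hsum.injective)
    rwa [card_insert_of_notMem hzX, hc, show m + 2 * ((n - m) / 2) + 1 = n by omega] at this

end Construction

/-! ### Complementation followed by transposition. -/

theorem asym_iff_asym_compl_symm {a b s : ℕ} (hb : b ≤ s ^ a) :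
    Asym a s b ↔ Asym (s ^ a - b) s a :=
  (asym_compl_iff hb).symm.trans ⟨Asym.symm, Asym.symm⟩

/-- If the complement size `N` is below `a`, exchange roles: both `a` and `N` are at most `s ^ (N -
1)`, so `a + N ≤ s ^ N` and the construction applies to `(N, a)`. -/
theorem asym_of_mul_le_pow {a b s : ℕ} (hs : 2 ≤ s) (he : Even s) (ha : 0 < a) (hab : a ≤ b)
    (hb : b ≤ s ^ a) (h : a * s ≤ s ^ (s ^ a - b)) : Asym a s b := by
  rcases le_or_gt a (s ^ a - b) with h1 | h1
  · exact asym_of_le_of_le hs he ha hab (by omega)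
  rw [asym_iff_asym_compl_symm hb]
  generalize s ^ a - b = N at *
  rcases N with _ | N
  · rw [pow_zero] at h
    nlinarith
  rw [pow_succ] at h
  have h2 : a ≤ s ^ N := le_of_mul_le_mul_right h (by omega)
  have h3 : N + 1 ≤ s ^ N := Nat.lt_pow_self (by omega)
  refine asym_of_le_of_le hs he N.succ_pos h1.le ?_
  rw [pow_succ]
  nlinarith

theorem asym_of_compl_eq_zero {a b s : ℕ} (hb : b ≤ s ^ a) (h : a ≤ 1) (h0 : s ^ a - b = 0) :
    Asym a s b := by
  rw [← asym_compl_iff hb, h0]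
  have : Subsingleton (Fin a) := Fin.subsingleton_iff_le_one.2 h
  exact ⟨∅, rfl, fun σ _ => Subsingleton.elim _ _⟩

theorem Asym.le_pow_compl {a b s : ℕ} (h : Asym a s b) : a ≤ s ^ (s ^ a - b) :=
  h.compl.symm.le_pow

/-! ### Oriented coloured bipartite graphs as matrices. -/

/-- Some orientation of `K_{m,n}` has a distinguishing arc colouring with `k` colours. -/
def HasDistinguishing (m n k : ℕ) : Prop :=
  ∃ D : Digraph (Fin m ⊕ Fin n), IsOrientation (completeBipartiteGraph (Fin m) (Fin n)) D ∧
    ∃ c : Arc D → Fin k, IsDistinguishing D c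

theorem minOrientedIndex_eq {m n k : ℕ} (h : HasDistinguishing m n k)
    (hmin : ∀ l, HasDistinguishing m n l → k ≤ l) :
    minOrientedIndex (completeBipartiteGraph (Fin m) (Fin n)) = k := by
  obtain ⟨D, hD, hc⟩ := h
  refine le_antisymm ?_ ?_
  · exact (iInf₂_le D hD).trans (iInf₂_le k hc)
  · refine le_iInf₂ fun D hD => le_iInf₂ fun l hl => ?_
    exact_mod_cast hmin l ⟨D, hD, hl⟩

theorem HasDistinguishing.asym {m n k : ℕ} (h : HasDistinguishing m n k) : Asym m (2 * k) n := by
  classical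
  obtain ⟨D, ⟨hD, hD'⟩, c, hc⟩ := h
  have hor : ∀ i j, ¬ D.Adj (.inl i) (.inr j) → D.Adj (.inr j) (.inl i) := fun i j hij =>
    ((hD (.inl i) (.inr j)).1 (by simp)).resolve_left hij
  have hll : ∀ i i', ¬ D.Adj (.inl i) (.inl i') := fun i i' h => by
    simpa using (hD (.inl i) (.inl i')).2 (.inl h)
  have hrr : ∀ i i', ¬ D.Adj (.inr i) (.inr i') := fun i i' h => by
    simpa using (hD (.inr i) (.inr i')).2 (.inl h)
  let M : Fin m → Fin n → Bool × Fin k := fun i j =>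
    if h : D.Adj (.inl i) (.inr j) then (true, c ⟨(.inl i, .inr j), h⟩)
    else (false, c ⟨(.inr j, .inl i), hor i j h⟩)
  have hMt : ∀ i j (h : D.Adj (.inl i) (.inr j)), M i j = (true, c ⟨(.inl i, .inr j), h⟩) :=
    fun i j h => dif_pos h
  have hMf : ∀ i j (h : D.Adj (.inr j) (.inl i)), M i j = (false, c ⟨(.inr j, .inl i), h⟩) :=
    fun i j h => dif_neg (hD' _ _ h)
  have hM : RigidMatrix M := by
    intro σ τ hστ
    have hadj : ∀ i j, D.Adj (.inl (σ i)) (.inr (τ j)) ↔ D.Adj (.inl i) (.inr j) := by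
      intro i j
      have hp : ∀ i j, D.Adj (.inl i) (.inr j) ↔ (M i j).1 = true := by
        intro i j
        by_cases h : D.Adj (.inl i) (.inr j)
        · simp [h, hMt _ _ h]
        · simp [h, hMf _ _ (hor _ _ h)]
      rw [hp, hp, hστ]
    have hadj' : ∀ i j, D.Adj (.inr (τ j)) (.inl (σ i)) ↔ D.Adj (.inr j) (.inl i) := by
      intro i j
      have hp : ∀ i j, D.Adj (.inr j) (.inl i) ↔ ¬ D.Adj (.inl i) (.inr j) := fun i j =>
        ⟨fun h => hD' _ _ h, hor i j⟩
      rw [hp, hp, hadj]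
    let φ : Aut D :=
      { toEquiv := Equiv.sumCongr σ τ
        map_rel_iff' := by
          rintro (i | i) (j | j)
          · simp [hll]
          · simpa using hadj i j
          · simpa using hadj' j i
          · simp [hrr] }
    have hφ := hc φ (by
      rintro ⟨⟨i | i, j | j⟩, hij⟩
      · exact absurd hij (hll _ _)
      · have h1 := hMt _ _ ((hadj i j).2 hij)
        rw [hστ, hMt _ _ hij] at h1
        exact (Prod.ext_iff.1 h1).2.symm
      · have h1 := hMf _ _ ((hadj' j i).2 hij)
        rw [hστ, hMf _ _ hij] at h1
        exact (Prod.ext_iff.1 h1).2.symm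
      · exact absurd hij (hrr _ _))
    exact ⟨Equiv.ext fun i => Sum.inl_injective (hφ (.inl i)),
      Equiv.ext fun j => Sum.inr_injective (hφ (.inr j))⟩
  let e : Bool × Fin k ≃ Fin (2 * k) := Fintype.equivFinOfCardEq (by simp)
  exact (hM.comp_injective e.injective).asym

section OfMatrix

variable {m n k : ℕ}

/-- The orientation of `K_{m,n}` whose directions are prescribed by a matrix. -/
def matrixDigraph (M : Fin m → Fin n → Bool × Fin k) : Digraph (Fin m ⊕ Fin n) where
  Adj
    | .inl i, .inr j => (M i j).1 = true
    | .inr j, .inl i => (M i j).1 = false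
    | _, _ => False

/-- The arc colouring prescribed by a matrix. -/
def matrixColouring (M : Fin m → Fin n → Bool × Fin k) : Arc (matrixDigraph M) → Fin k
  | ⟨(.inl i, .inr j), _⟩ => (M i j).2
  | ⟨(.inr j, .inl i), _⟩ => (M i j).2
  | ⟨(.inl _, .inl _), h⟩ => h.elim
  | ⟨(.inr _, .inr _), h⟩ => h.elim

theorem isOrientation_matrixDigraph (M : Fin m → Fin n → Bool × Fin k) :
    IsOrientation (completeBipartiteGraph (Fin m) (Fin n)) (matrixDigraph M) := by
  constructor
  · rintro (i | i) (j | j)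
    · simp [matrixDigraph]
    · simp [matrixDigraph]
    · simp [matrixDigraph]
    · simp [matrixDigraph]
  · rintro (i | i) (j | j) <;> simp [matrixDigraph]

theorem matrixDigraph_adj_or_adj (M : Fin m → Fin n → Bool × Fin k) (x y : Fin m ⊕ Fin n) :
    (matrixDigraph M).Adj x y ∨ (matrixDigraph M).Adj y x ↔ x.isLeft ≠ y.isLeft := by
  rw [← (isOrientation_matrixDigraph M).1]
  rcases x with x | x <;> rcases y with y | y <;> simp

/-- An automorphism respects the bipartition, so it fixes both sides or exchanges them; `hswap`
excludes the exchange, and rigidity handles the rest. -/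
theorem isDistinguishing_matrixColouring {M : Fin m → Fin n → Bool × Fin k} (hM : RigidMatrix M)
    (hswap : ∀ φ : Aut (matrixDigraph M), ¬ ∀ x, (φ x).isLeft ≠ x.isLeft) :
    IsDistinguishing (matrixDigraph M) (matrixColouring M) := by
  intro φ hφ
  have hpart : ∀ x y : Fin m ⊕ Fin n,
      ((φ x).isLeft ≠ (φ y).isLeft) ↔ (x.isLeft ≠ y.isLeft) := by
    intro x y
    rw [← matrixDigraph_adj_or_adj M, ← matrixDigraph_adj_or_adj M, φ.map_rel_iff, φ.map_rel_iff]
  have hleft : ∀ x, (φ x).isLeft = x.isLeft := by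
    have := hswap φ
    push Not at this
    obtain ⟨x, hx⟩ := this
    intro y
    have := hpart x y
    rw [hx] at this
    revert this
    cases (φ y).isLeft <;> cases y.isLeft <;> cases x.isLeft <;> simp
  have h1 : ∀ i, ∃ i', φ (.inl i) = .inl i' := fun i => Sum.isLeft_iff.1 (hleft (.inl i))
  have h2 : ∀ j, ∃ j', φ (.inr j) = .inr j' := fun j => by
    have := hleft (.inr j)
    simpa [Sum.isLeft_eq_false, Sum.isRight_iff] using this
  choose σ hσ using h1
  choose τ hτ using h2
  have hσi : Function.Injective σ := fun i i' h => by
    have : φ (.inl i) = φ (.inl i') := by rw [hσ, hσ, h]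
    exact Sum.inl_injective (φ.injective this)
  have hτi : Function.Injective τ := fun i i' h => by
    have : φ (.inr i) = φ (.inr i') := by rw [hτ, hτ, h]
    exact Sum.inr_injective (φ.injective this)
  have key := hM (Equiv.ofBijective σ (Finite.injective_iff_bijective.1 hσi))
    (Equiv.ofBijective τ (Finite.injective_iff_bijective.1 hτi)) (by
      intro i j
      rw [Equiv.ofBijective_apply, Equiv.ofBijective_apply]
      have hadj : (M (σ i) (τ j)).1 = true ↔ (M i j).1 = true := by
        have := φ.map_rel_iff (a := .inl i) (b := .inr j)
        rw [hσ, hτ] at this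
        exact this
      refine Prod.ext (Bool.eq_iff_iff.2 hadj) ?_
      cases hb : (M i j).1
      · have hij : (matrixDigraph M).Adj (.inr j) (.inl i) := hb
        have h3 := hφ ⟨(.inr j, .inl i), hij⟩
        have h4 : Aut.onArc φ ⟨(.inr j, .inl i), hij⟩ =
            ⟨(.inr (τ j), .inl (σ i)), by rw [← hσ, ← hτ]; exact φ.map_rel_iff.2 hij⟩ :=
          Subtype.ext (Prod.ext (hτ j) (hσ i))
        rw [h4] at h3
        exact h3
      · have hij : (matrixDigraph M).Adj (.inl i) (.inr j) := hb
        have h3 := hφ ⟨(.inl i, .inr j), hij⟩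
        have h4 : Aut.onArc φ ⟨(.inl i, .inr j), hij⟩ =
            ⟨(.inl (σ i), .inr (τ j)), by rw [← hσ, ← hτ]; exact φ.map_rel_iff.2 hij⟩ :=
          Subtype.ext (Prod.ext (hσ i) (hτ j))
        rw [h4] at h3
        exact h3)
  rintro (i | j)
  · rw [hσ]
    exact congrArg Sum.inl (Equiv.ext_iff.1 key.1 i)
  · rw [hτ]
    exact congrArg Sum.inr (Equiv.ext_iff.1 key.2 j)

end OfMatrix

theorem Asym.hasDistinguishing {m n k : ℕ} (hmn : m < n) (h : Asym m (2 * k) n) :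
    HasDistinguishing m n k := by
  obtain ⟨M, hM⟩ := h.exists_rigidMatrix
  let e : Fin (2 * k) ≃ Bool × Fin k := (Fintype.equivFinOfCardEq (by simp)).symm
  refine ⟨_, isOrientation_matrixDigraph _, _,
    isDistinguishing_matrixColouring (hM.comp_injective e.injective) fun φ hφ => ?_⟩
  have h1 : ∀ j : Fin n, ∃ i : Fin m, φ (.inr j) = .inl i := fun j => by
    have := hφ (.inr j)
    simpa [Sum.isLeft_iff] using this
  choose f hf using h1
  have hfi : Function.Injective f := fun j j' hj => by
    have : φ (.inr j) = φ (.inr j') := by rw [hf, hf, hj]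
    exact Sum.inr_injective (φ.injective this)
  have := Fintype.card_le_of_injective f hfi
  simp only [Fintype.card_fin] at this
  omega

/-- Orienting by `i < j` makes the order on rows and columns recoverable, so side-preserving
automorphisms are trivial even with one colour used. A swap is impossible: the last left vertex is a
sink, while every right vertex has an outgoing arc. -/
theorem hasDistinguishing_self {m k : ℕ} (hm : 0 < m) (hk : 0 < k) : HasDistinguishing m m k := by
  let M : Fin m → Fin m → Bool × Fin k := fun i j => (decide (i < j), ⟨0, hk⟩)
  have hM : RigidMatrix M := by
    intro σ τ h
    have hlt : ∀ i j, σ i < τ j ↔ i < j := fun i j => by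
      have := congrArg Prod.fst (h i j)
      simpa [M] using this
    have hrow : ∀ i i' : Fin m, i ≤ i' ↔ ∀ j, i' < j → i < j := fun i i' =>
      ⟨fun h j hj => h.trans_lt hj, fun h => not_lt.1 fun hi => (h i hi).false⟩
    have hcol : ∀ j j' : Fin m, j ≤ j' ↔ ∀ i, i < j → i < j' := fun j j' =>
      ⟨fun h i hi => hi.trans_le h, fun h => not_lt.1 fun hj => (h j' hj).false⟩
    let eσ : Fin m ≃o Fin m :=
      { toEquiv := σ
        map_rel_iff' := by
          intro i i'
          rw [hrow, hrow i, ← τ.forall_congr_right]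
          simp only [hlt] }
    let eτ : Fin m ≃o Fin m :=
      { toEquiv := τ
        map_rel_iff' := by
          intro j j'
          rw [hcol, hcol j, ← σ.forall_congr_right]
          simp only [hlt] }
    exact ⟨congrArg RelIso.toEquiv (Subsingleton.elim eσ (OrderIso.refl _)),
      congrArg RelIso.toEquiv (Subsingleton.elim eτ (OrderIso.refl _))⟩
  refine ⟨_, isOrientation_matrixDigraph M, _, isDistinguishing_matrixColouring hM fun φ hφ => ?_⟩
  let a : Fin m := ⟨m - 1, by omega⟩
  obtain ⟨b, hb⟩ : ∃ b, φ (.inl a) = .inr b := by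
    have := hφ (.inl a)
    simpa [Sum.isLeft_eq_false, Sum.isRight_iff] using this
  have h1 : (matrixDigraph M).Adj (.inr b) (.inl b) := by simp [matrixDigraph, M]
  rw [← hb, ← φ.apply_symm_apply (.inl b), φ.map_rel_iff] at h1
  rcases hx : φ.symm (.inl b) with c | c
  · rw [hx] at h1
    exact h1
  · rw [hx] at h1
    have h2 : a < c := by simpa [matrixDigraph, M] using h1
    have h3 := c.2
    have h4 : m - 1 < c.1 := h2
    omega

theorem minOrientedIndex_completeBipartiteGraph {m n r : ℕ} (hm : 0 < m) (hmn : m ≤ n)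
    (hr : 2 ≤ r) (h1 : (r - 1) ^ m < n) (h2 : n ≤ r ^ m) [Decidable (Even r ∧ Asym m r n)] :
    minOrientedIndex (completeBipartiteGraph (Fin m) (Fin n)) =
      ((if Even r ∧ Asym m r n then r / 2 else r / 2 + 1 : ℕ) : ℕ∞) := by
  have hlow : ∀ l, HasDistinguishing m n l → r ≤ 2 * l := fun l hl => by
    have := lt_of_pow_lt_pow_left₀ m (Nat.zero_le _) (h1.trans_le hl.asym.le_pow)
    omega
  have hup : ∀ k, 0 < k → Asym m (2 * k) n → HasDistinguishing m n k := fun k hk h => by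
    rcases hmn.lt_or_eq with h' | rfl
    · exact h.hasDistinguishing h'
    · exact hasDistinguishing_self hm hk
  split_ifs with h
  · obtain ⟨he, ha⟩ := h
    have h2r : 2 * (r / 2) = r := Nat.two_mul_div_two_of_even he
    refine minOrientedIndex_eq (hup _ (by omega) (by rwa [h2r])) fun l hl => ?_
    have := hlow l hl
    omega
  · refine minOrientedIndex_eq (hup _ (by omega) ?_) fun l hl => ?_
    · refine asym_of_le_of_le (by omega) (even_two_mul _) hm hmn ?_
      have h3 : (r + 1) ^ m ≤ (2 * (r / 2 + 1)) ^ m := Nat.pow_le_pow_left (by omega) m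
      -- One extra symbol already leaves the `m` spare words that the construction requires.
      have h4 : r ^ m + m ≤ (r + 1) ^ m := by
        clear * - hr
        induction m with
        | zero => simp
        | succ m ih =>
          rw [pow_succ, pow_succ]
          have : 1 ≤ (r + 1) ^ m := Nat.one_le_pow _ _ (by omega)
          nlinarith
      omega
    · by_contra hlt
      have h3 := hlow l hl
      have h4 : 2 * l = r := by omega
      exact h ⟨h4 ▸ even_two_mul l, h4 ▸ hl.asym⟩

/-! ### The register machine program and its analysis. -/

/-- Started in the configuration `s`, the program `P` halts after at most `T` steps with `v` in
register `0`, and no register ever holds a number greater than `B`. -/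
def HaltsWithin (P : List Instr) (v B T : ℕ) (s : Config) : Prop :=
  (∃ t ≤ T, P.length ≤ ((step P)^[t] s).pc ∧ ((step P)^[t] s).reg 0 = v) ∧
    ∀ t i, ((step P)^[t] s).reg i ≤ B

theorem HaltsWithin.mono {P : List Instr} {v B T T' : ℕ} {s : Config}
    (h : HaltsWithin P v B T s) (hT : T ≤ T') : HaltsWithin P v B T' s := by
  obtain ⟨⟨t, ht, h⟩, hB⟩ := h
  exact ⟨⟨t, ht.trans hT, h⟩, hB⟩

theorem HaltsWithin.of_step {P : List Instr} {v B T : ℕ} {s s' : Config} (hs : step P s = s')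
    (hB : ∀ i, s.reg i ≤ B) (h : HaltsWithin P v B T s') : HaltsWithin P v B (T + 1) s := by
  subst hs
  obtain ⟨⟨t, ht, h⟩, hB'⟩ := h
  refine ⟨⟨t + 1, by omega, h⟩, fun t i => ?_⟩
  cases t with
  | zero => exact hB i
  | succ t => exact hB' t i

theorem haltsWithin_zero {P : List Instr} {v B : ℕ} {s : Config} (hs : P.length ≤ s.pc)
    (hv : s.reg 0 = v) (hB : ∀ i, s.reg i ≤ B) : HaltsWithin P v B 0 s := by
  refine ⟨⟨0, le_rfl, hs, hv⟩, fun t i => ?_⟩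
  have : step P s = s := by
    simp only [step, List.getElem?_eq_none hs]
  rw [Function.iterate_fixed this]
  exact hB i

/-- On input `(m, n, r)` with `n = r ^ m - ⌈log_r m⌉`, this program computes the index of
`K_{m,n}`: it replaces `(m, n)` by `(r ^ m - n, m)` until the answer is clear. -/
def program : List Instr :=
  [.const 5 2, .arith .div 6 2 5, .arith .mul 5 6 5, .jle 2 5 5, .jle 7 7 19,
    .arith .pow 3 2 0, .arith .sub 3 3 1, .jle 0 3 17, .arith .pow 4 2 3, .jle 0 4 11,
    .jle 7 7 19, .arith .mul 5 0 2, .jle 5 4 17, .jle 3 7 17, .arith .add 1 0 7,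
    .arith .add 0 3 7, .jle 7 7 5, .arith .add 0 6 7, .jle 7 7 21, .const 5 1,
    .arith .add 0 6 5]

/-- The register contents `a, b, s, N, p, t, h, 0, 0, …`. -/
def regs (a b s N p t h : ℕ) : ℕ → ℕ
  | 0 => a
  | 1 => b
  | 2 => s
  | 3 => N
  | 4 => p
  | 5 => t
  | 6 => h
  | _ => 0

section Registers

variable {a b s N p t h x B v : ℕ}

theorem update_regs_zero : Function.update (regs a b s N p t h) 0 x = regs x b s N p t h := by
  funext i
  rcases i with _ | _ | _ | _ | _ | _ | _ | i <;> simp [regs, Function.update]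

theorem update_regs_one : Function.update (regs a b s N p t h) 1 x = regs a x s N p t h := by
  funext i
  rcases i with _ | _ | _ | _ | _ | _ | _ | i <;> simp [regs, Function.update]

theorem update_regs_three : Function.update (regs a b s N p t h) 3 x = regs a b s x p t h := by
  funext i
  rcases i with _ | _ | _ | _ | _ | _ | _ | i <;> simp [regs, Function.update]

theorem update_regs_four : Function.update (regs a b s N p t h) 4 x = regs a b s N x t h := by
  funext i
  rcases i with _ | _ | _ | _ | _ | _ | _ | i <;> simp [regs, Function.update]

theorem update_regs_five : Function.update (regs a b s N p t h) 5 x = regs a b s N p x h := by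
  funext i
  rcases i with _ | _ | _ | _ | _ | _ | _ | i <;> simp [regs, Function.update]

theorem update_regs_six : Function.update (regs a b s N p t h) 6 x = regs a b s N p t x := by
  funext i
  rcases i with _ | _ | _ | _ | _ | _ | _ | i <;> simp [regs, Function.update]

theorem regs_le (ha : a ≤ B) (hb : b ≤ B) (hs : s ≤ B) (hN : N ≤ B) (hp : p ≤ B) (ht : t ≤ B)
    (hh : h ≤ B) (i : ℕ) : regs a b s N p t h i ≤ B := by
  rcases i with _ | _ | _ | _ | _ | _ | _ | i
  all_goals first | assumption | exact Nat.zero_le _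

theorem haltsWithin_accept (ha : a ≤ B) (hb : b ≤ B) (hs : s ≤ B) (hN : N ≤ B) (hp : p ≤ B)
    (ht : t ≤ B) (hh : h ≤ B) : HaltsWithin program h B 2 ⟨17, regs a b s N p t h⟩ := by
  refine .of_step (s' := ⟨18, regs h b s N p t h⟩) ?_ (regs_le ha hb hs hN hp ht hh)
    (.of_step (s' := ⟨21, regs h b s N p t h⟩) ?_ (regs_le hh hb hs hN hp ht hh)
      (haltsWithin_zero le_rfl rfl (regs_le hh hb hs hN hp ht hh)))
  · simp [step, program, update_regs_zero, regs, Op.eval]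
  · simp [step, program]

theorem haltsWithin_reject (ha : a ≤ B) (hb : b ≤ B) (hs : s ≤ B) (hN : N ≤ B) (hp : p ≤ B)
    (ht : t ≤ B) (hh : h + 1 ≤ B) :
    HaltsWithin program (h + 1) B 2 ⟨19, regs a b s N p t h⟩ := by
  have hh' : h ≤ B := by omega
  have h1 : 1 ≤ B := by omega
  refine .of_step (s' := ⟨20, regs a b s N p 1 h⟩) ?_ (regs_le ha hb hs hN hp ht hh')
    (.of_step (s' := ⟨21, regs (h + 1) b s N p 1 h⟩) ?_ (regs_le ha hb hs hN hp h1 hh')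
      (haltsWithin_zero le_rfl rfl (regs_le hh hb hs hN hp h1 hh')))
  · simp [step, program, update_regs_five]
  · simp [step, program, update_regs_zero, regs, Op.eval]

/-- One pass through the loop. -/
theorem haltsWithin_loop {T : ℕ} (hs2 : 2 ≤ s) (ha : a ≤ B) (hb : b ≤ B) (hs : s ≤ B)
    (hN : N ≤ B) (hp : p ≤ B) (ht : t ≤ B) (hh : h + 1 ≤ B) (hpow : s ^ a ≤ B) (hmul : a * s ≤ B)
    (hT : 2 ≤ T)
    (h_le : a ≤ s ^ a - b → v = h)
    (h_lt : s ^ (s ^ a - b) < a → v = h + 1)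
    (h_mul : a * s ≤ s ^ (s ^ a - b) → v = h)
    (h_zero : s ^ a - b = 0 → a ≤ 1 → v = h)
    (h_next : 0 < s ^ a - b → s ^ a - b < a → a ≤ s ^ (s ^ a - b) → s ^ (s ^ a - b) < a * s →
      HaltsWithin program v B T ⟨5, regs (s ^ a - b) a s (s ^ a - b) (s ^ (s ^ a - b)) (a * s) h⟩) :
    HaltsWithin program v B (T + 11) ⟨5, regs a b s N p t h⟩ := by
  have hh' : h ≤ B := by omega
  have hsub : s ^ a - b ≤ B := (Nat.sub_le _ _).trans hpow
  refine .of_step (s' := ⟨6, regs a b s (s ^ a) p t h⟩)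
    (by simp [step, program, update_regs_three, regs, Op.eval])
    (regs_le ha hb hs hN hp ht hh') ?_
  refine .of_step (s' := ⟨7, regs a b s (s ^ a - b) p t h⟩)
    (by simp [step, program, update_regs_three, regs, Op.eval])
    (regs_le ha hb hs hpow hp ht hh') ?_
  generalize hM : s ^ a - b = M at *
  by_cases h1 : a ≤ M
  · refine .of_step (s' := ⟨17, regs a b s M p t h⟩) (by simp [step, program, regs, h1])
      (regs_le ha hb hs hsub hp ht hh') ?_
    rw [h_le h1]
    exact (haltsWithin_accept ha hb hs hsub hp ht hh').mono (by omega)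
  -- The second power is computed only once `M < a` is known, so `s ^ a` bounds it.
  have hpow' : s ^ M ≤ B := (Nat.pow_le_pow_right (by omega) (by omega)).trans hpow
  refine .of_step (s' := ⟨8, regs a b s M p t h⟩) (by simp [step, program, regs, h1])
    (regs_le ha hb hs hsub hp ht hh') ?_
  refine .of_step (s' := ⟨9, regs a b s M (s ^ M) t h⟩)
    (by simp [step, program, update_regs_four, regs, Op.eval])
    (regs_le ha hb hs hsub hp ht hh') ?_
  by_cases h2 : a ≤ s ^ M
  swap
  · refine .of_step (s' := ⟨10, regs a b s M (s ^ M) t h⟩) (by simp [step, program, regs, h2])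
      (regs_le ha hb hs hsub hpow' ht hh') ?_
    -- Register 7 is always zero, so comparing it with itself is an unconditional jump.
    refine .of_step (s' := ⟨19, regs a b s M (s ^ M) t h⟩) (by simp [step, program])
      (regs_le ha hb hs hsub hpow' ht hh') ?_
    rw [h_lt (by omega)]
    exact (haltsWithin_reject ha hb hs hsub hpow' ht hh).mono (by omega)
  refine .of_step (s' := ⟨11, regs a b s M (s ^ M) t h⟩) (by simp [step, program, regs, h2])
      (regs_le ha hb hs hsub hpow' ht hh') ?_
  refine .of_step (s' := ⟨12, regs a b s M (s ^ M) (a * s) h⟩)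
    (by simp [step, program, update_regs_five, regs, Op.eval])
    (regs_le ha hb hs hsub hpow' ht hh') ?_
  by_cases h3 : a * s ≤ s ^ M
  · refine .of_step (s' := ⟨17, regs a b s M (s ^ M) (a * s) h⟩)
      (by simp [step, program, regs, h3]) (regs_le ha hb hs hsub hpow' hmul hh') ?_
    rw [h_mul h3]
    exact (haltsWithin_accept ha hb hs hsub hpow' hmul hh').mono (by omega)
  refine .of_step (s' := ⟨13, regs a b s M (s ^ M) (a * s) h⟩)
      (by simp [step, program, regs, h3]) (regs_le ha hb hs hsub hpow' hmul hh') ?_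
  by_cases h4 : M = 0
  · refine .of_step (s' := ⟨17, regs a b s M (s ^ M) (a * s) h⟩)
      (by simp [step, program, regs, h4]) (regs_le ha hb hs hsub hpow' hmul hh') ?_
    rw [h_zero h4 (by simpa [h4] using h2)]
    exact (haltsWithin_accept ha hb hs hsub hpow' hmul hh').mono (by omega)
  refine .of_step (s' := ⟨14, regs a b s M (s ^ M) (a * s) h⟩)
      (by simp [step, program, regs, h4]) (regs_le ha hb hs hsub hpow' hmul hh') ?_
  refine .of_step (s' := ⟨15, regs a a s M (s ^ M) (a * s) h⟩)
    (by simp [step, program, update_regs_one, regs, Op.eval])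
    (regs_le ha hb hs hsub hpow' hmul hh') ?_
  refine .of_step (s' := ⟨16, regs M a s M (s ^ M) (a * s) h⟩)
    (by simp [step, program, update_regs_zero, regs, Op.eval])
    (regs_le ha ha hs hsub hpow' hmul hh') ?_
  refine .of_step (s' := ⟨5, regs M a s M (s ^ M) (a * s) h⟩) (by simp [step, program])
    (regs_le hsub ha hs hsub hpow' hmul hh') ?_
  exact (h_next (by omega) (by omega) h2 (by omega)).mono (by omega)

end Registers

/-- The invariant `a < x + 1` survives replacing `x` by its logarithm, and `x ≤ 1` forces `a ≤ 1`,
where no further pass can occur. -/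
theorem haltsWithin_of_iterate_logb_le_one {s h v B : ℕ} (hs2 : 2 ≤ s) (he : Even s) (hs : s ≤ B)
    (hh : h + 1 ≤ B) (k : ℕ) : ∀ (x : ℝ) (a b N p t : ℕ), (Real.logb 2)^[k] x ≤ 1 →
    (a : ℝ) < x + 1 → 0 < a → a ≤ b → b ≤ s ^ a → b ≤ B → N ≤ B → p ≤ B → t ≤ B → s ^ a ≤ B →
    a * s ≤ B → (Asym a s b → v = h) → (¬ Asym a s b → v = h + 1) →
    HaltsWithin program v B (12 * k + 13) ⟨5, regs a b s N p t h⟩ := by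
  induction k with
  | zero =>
    intro x a b N p t hx hax ha hab hb hbB hN hp ht hpow hmul hv hv'
    have ha1 : a ≤ 1 := by
      rw [Function.iterate_zero_apply] at hx
      have : (a : ℝ) < 2 := by linarith
      have : a < 2 := by exact_mod_cast this
      omega
    refine (haltsWithin_loop (T := 2) hs2 (hab.trans hbB) hbB hs hN hp ht hh hpow hmul le_rfl
      ?_ ?_ ?_ ?_ ?_)
    · exact fun h1 => hv (asym_of_le_of_le hs2 he ha hab (by omega))
    · exact fun h1 => hv' fun h2 => absurd h2.le_pow_compl (by omega)
    · exact fun h1 => hv (asym_of_mul_le_pow hs2 he ha hab hb h1)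
    · exact fun h1 h2 => hv (asym_of_compl_eq_zero hb h2 h1)
    · intro h1 h2
      omega
  | succ k ih =>
    intro x a b N p t hx hax ha hab hb hbB hN hp ht hpow hmul hv hv'
    refine (haltsWithin_loop (T := 12 * k + 13) hs2 (hab.trans hbB) hbB hs hN hp ht hh hpow hmul
      (by omega) ?_ ?_ ?_ ?_ ?_).mono (by omega)
    · exact fun h1 => hv (asym_of_le_of_le hs2 he ha hab (by omega))
    · exact fun h1 => hv' fun h2 => absurd h2.le_pow_compl (by omega)
    · exact fun h1 => hv (asym_of_mul_le_pow hs2 he ha hab hb h1)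
    · exact fun h1 h2 => hv (asym_of_compl_eq_zero hb h2 h1)
    · intro h1 h2 h3 h4
      have hiff := asym_iff_asym_compl_symm hb
      generalize s ^ a - b = M at *
      have hM : s ^ M ≤ s ^ a := Nat.pow_le_pow_right (by omega) h2.le
      have haB := hab.trans hbB
      refine ih (Real.logb 2 x) M a M (s ^ M) (a * s) ?_ ?_ h1 h2.le h3 haB (h2.le.trans haB)
        (hM.trans hpow) hmul (hM.trans hpow) ?_ (fun h => hv (hiff.2 h))
        (fun h => hv' fun h' => h (hiff.1 h'))
      · rwa [Function.iterate_succ_apply] at hx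
      -- Writing the new entry as `M + 1`, failure of the sufficient test gives `s ^ M < a`, hence
      -- `2 ^ M < x`; the slack of one in the invariant absorbs the shift.
      · obtain ⟨M, rfl⟩ := Nat.exists_eq_add_of_lt h1
        rw [zero_add] at *
        have h5 : 2 ^ M + 1 ≤ a := by
          have h6 : s ^ M < a := by
            rw [pow_succ] at h4
            exact lt_of_mul_lt_mul_right h4 (Nat.zero_le _)
          have h7 : 2 ^ M ≤ s ^ M := Nat.pow_le_pow_left hs2 M
          omega
        have h6 : (2 : ℝ) ^ M + 1 ≤ a := by exact_mod_cast h5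
        have h7 : (2 : ℝ) ^ M < x := by linarith
        have h8 : (0 : ℝ) < 2 ^ M := by positivity
        have : (M : ℝ) < Real.logb 2 x := by
          rw [Real.lt_logb_iff_rpow_lt one_lt_two (h8.trans h7), Real.rpow_natCast]
          exact h7
        push_cast
        linarith
      · exact (Nat.mul_le_mul_right s h2.le).trans hmul

theorem exists_iterate_logb_le_one (a : ℕ) : ∀ x : ℝ, x ≤ a → ∃ k, (Real.logb 2)^[k] x ≤ 1 := by
  induction a with
  | zero =>
    intro x hx
    refine ⟨0, ?_⟩
    rw [Nat.cast_zero] at hx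
    simpa using hx.trans zero_le_one
  | succ a ih =>
    intro x hx
    rcases le_or_gt x 1 with h | h
    · exact ⟨0, h⟩
    have h1 : Real.logb 2 x ≤ a := by
      rw [Real.logb_le_iff_le_rpow one_lt_two (by linarith), Real.rpow_natCast]
      refine hx.trans ?_
      have : a + 1 ≤ 2 ^ a := Nat.lt_pow_self one_lt_two
      exact_mod_cast this
    obtain ⟨k, hk⟩ := ih _ h1
    exact ⟨k + 1, hk⟩

theorem iterate_logStar_le_one (n : ℕ) : (Real.logb 2)^[logStar n] (n : ℝ) ≤ 1 :=
  Nat.sInf_mem (s := {k : ℕ | (Real.logb 2)^[k] (n : ℝ) ≤ 1}) (exists_iterate_logb_le_one n n le_rfl)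

theorem logStar_pos {n : ℕ} (hn : 2 ≤ n) : 0 < logStar n := by
  by_contra! h
  have := iterate_logStar_le_one n
  rw [Nat.le_zero.1 h, Function.iterate_zero_apply] at this
  have : n ≤ 1 := by exact_mod_cast this
  omega

theorem initial_eq (m n r : ℕ) : initial m n r = ⟨0, regs m n r 0 0 0 0⟩ := by
  have : (initial m n r).reg = regs m n r 0 0 0 0 := by
    funext i
    rcases i with _ | _ | _ | _ | _ | _ | _ | i <;> rfl
  rw [← this]
  rfl

theorem computesWithin_program {m n r v : ℕ} (hm : 0 < m) (hmn : m ≤ n) (hn : 2 ≤ n) (hr : 2 ≤ r)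
    (hrn : r ≤ n) (h2 : n ≤ r ^ m) (hpow : r ^ m ≤ 2 * n)
    (hv : Even r ∧ Asym m r n → v = r / 2) (hv' : ¬ (Even r ∧ Asym m r n) → v = r / 2 + 1) :
    ComputesWithin program m n r v (40 * logStar n) (n ^ 40) := by
  have hB2 : n ^ 2 ≤ n ^ 40 := Nat.pow_le_pow_right (by omega) (by norm_num)
  generalize n ^ 40 = B at *
  rw [sq] at hB2
  have hnB : n ≤ B := (Nat.le_mul_of_pos_left n (by omega)).trans hB2
  have hT := logStar_pos hn
  suffices h : HaltsWithin program v B (40 * logStar n) ⟨0, regs m n r 0 0 0 0⟩ by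
    rw [← initial_eq] at h
    exact h
  have z : 0 ≤ B := Nat.zero_le _
  have hmB := hmn.trans hnB
  have hrB := hrn.trans hnB
  have h2B := hn.trans hnB
  have hhB : r / 2 + 1 ≤ B := by omega
  have hhB' : r / 2 ≤ B := by omega
  have htB : r / 2 * 2 ≤ B := (Nat.div_mul_le_self r 2).trans hrB
  -- Positivity of `logStar n` absorbs the additive constants.
  refine HaltsWithin.mono (T := 12 * logStar n + 13 + 1 + 1 + 1 + 1) ?_ (by omega)
  refine .of_step (s' := ⟨1, regs m n r 0 0 2 0⟩)
    (by simp [step, program, update_regs_five]) (regs_le hmB hnB hrB z z z z) ?_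
  refine .of_step (s' := ⟨2, regs m n r 0 0 2 (r / 2)⟩)
    (by simp [step, program, update_regs_six, regs, Op.eval]) (regs_le hmB hnB hrB z z h2B z) ?_
  refine .of_step (s' := ⟨3, regs m n r 0 0 (r / 2 * 2) (r / 2)⟩)
    (by simp [step, program, update_regs_five, regs, Op.eval])
    (regs_le hmB hnB hrB z z h2B hhB') ?_
  by_cases he : Even r
  · have hle : r ≤ r / 2 * 2 := (Nat.div_two_mul_two_of_even he).ge
    refine .of_step (s' := ⟨5, regs m n r 0 0 (r / 2 * 2) (r / 2)⟩)
      (by simp [step, program, regs, hle]) (regs_le hmB hnB hrB z z htB hhB') ?_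
    exact haltsWithin_of_iterate_logb_le_one hr he hrB hhB _ n m n 0 0 _
      (iterate_logStar_le_one n) (by exact_mod_cast Nat.lt_succ_of_le hmn) hm hmn h2 hnB z z htB
      (hpow.trans ((Nat.mul_le_mul_right n hn).trans hB2)) ((Nat.mul_le_mul hmn hrn).trans hB2)
      (fun h => hv ⟨he, h⟩) (fun h => hv' fun h' => h h'.2)
  · have hle : ¬ r ≤ r / 2 * 2 := by
      intro h
      exact he ⟨r / 2, by omega⟩
    refine HaltsWithin.mono (T := 2 + 1 + 1) ?_ (by omega)
    refine .of_step (s' := ⟨4, regs m n r 0 0 (r / 2 * 2) (r / 2)⟩)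
      (by simp [step, program, regs, hle]) (regs_le hmB hnB hrB z z htB hhB') ?_
    refine .of_step (s' := ⟨19, regs m n r 0 0 (r / 2 * 2) (r / 2)⟩)
      (by simp [step, program]) (regs_le hmB hnB hrB z z htB hhB') ?_
    rw [hv' fun h => he h.1]
    exact haltsWithin_reject hmB hnB hrB z z htB hhB

/-! ### Translating the ceilings. -/

theorem ceil_logb_le_iff {m r N : ℕ} (hm : 0 < m) (hr : 2 ≤ r) :
    ⌈Real.logb r m⌉ ≤ (N : ℤ) ↔ m ≤ r ^ N := by
  rw [Int.ceil_le, Int.cast_natCast, Real.logb_le_iff_le_rpow (by exact_mod_cast hr)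
    (by exact_mod_cast hm), Real.rpow_natCast]
  exact_mod_cast Iff.rfl

theorem ceil_half (r : ℕ) : ⌈(r : ℚ) / 2⌉₊ = (r + 1) / 2 := by
  apply le_antisymm
  · rw [Nat.ceil_le, div_le_iff₀ two_pos]
    have : r ≤ (r + 1) / 2 * 2 := by omega
    exact_mod_cast this
  · have h : (r : ℚ) / 2 ≤ ⌈(r : ℚ) / 2⌉₊ := Nat.le_ceil _
    rw [div_le_iff₀ two_pos] at h
    have : r ≤ ⌈(r : ℚ) / 2⌉₊ * 2 := by exact_mod_cast h
    omega

theorem ceil_succ_half (r : ℕ) : ⌈((r : ℚ) + 1) / 2⌉₊ = r / 2 + 1 := by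
  have := ceil_half (r + 1)
  push_cast at this
  rw [this]
  omega

end OrientedIndex

theorem mainTheorem7 :
    (∀ m n r : ℕ, m ≤ n → 2 ≤ r → (r - 1) ^ m < n → n ≤ r ^ m →
      ((n : ℤ) ≤ (r : ℤ) ^ m - ⌈Real.logb r m⌉ - 1 →
        OrientedIndex.minOrientedIndex (completeBipartiteGraph (Fin m) (Fin n)) =
          (⌈(r : ℚ) / 2⌉₊ : ℕ∞)) ∧
      ((n : ℤ) ≥ (r : ℤ) ^ m - ⌈Real.logb r m⌉ + 1 →
        OrientedIndex.minOrientedIndex (completeBipartiteGraph (Fin m) (Fin n)) =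
          (⌈((r : ℚ) + 1) / 2⌉₊ : ℕ∞)) ∧
      ((n : ℤ) = (r : ℤ) ^ m - ⌈Real.logb r m⌉ →
        OrientedIndex.minOrientedIndex (completeBipartiteGraph (Fin m) (Fin n)) =
          (⌈(r : ℚ) / 2⌉₊ : ℕ∞) ∨
        OrientedIndex.minOrientedIndex (completeBipartiteGraph (Fin m) (Fin n)) =
          (⌈((r : ℚ) + 1) / 2⌉₊ : ℕ∞))) ∧
    (∃ (P : List OrientedIndex.Instr) (C : ℕ),
      ∀ m n r : ℕ, m ≤ n → 2 ≤ r → (r - 1) ^ m < n → n ≤ r ^ m →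
        (n : ℤ) = (r : ℤ) ^ m - ⌈Real.logb r m⌉ →
        ∃ v : ℕ,
          OrientedIndex.minOrientedIndex (completeBipartiteGraph (Fin m) (Fin n)) = (v : ℕ∞) ∧
          OrientedIndex.ComputesWithin P m n r v (C * OrientedIndex.logStar n) (n ^ C)) := by
  classical
  have hpos : ∀ m n r : ℕ, (r - 1) ^ m < n → n ≤ r ^ m → 0 < m := by
    intro m n r h1 h2
    rcases Nat.eq_zero_or_pos m with rfl | h
    · rw [pow_zero] at h1 h2
      omega
    · exact h
  constructor
  · intro m n r hmn hr h1 h2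
    have hm := hpos m n r h1 h2
    rw [OrientedIndex.minOrientedIndex_completeBipartiteGraph hm hmn hr h1 h2,
      OrientedIndex.ceil_half, OrientedIndex.ceil_succ_half]
    have hcast : ((r ^ m - n : ℕ) : ℤ) = (r : ℤ) ^ m - n := by
      rw [Nat.cast_sub h2, Nat.cast_pow]
    by_cases he : Even r
    swap
    -- For odd `r` the two candidate values coincide.
    · have : (r + 1) / 2 = r / 2 + 1 := by
        obtain ⟨k, rfl⟩ := Nat.not_even_iff_odd.1 he
        omega
      simp [he, this]
    have hhalf : (r + 1) / 2 = r / 2 := by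
      obtain ⟨k, rfl⟩ := he
      omega
    rw [hhalf]
    refine ⟨fun h => ?_, fun h => ?_, fun _ => ?_⟩
    · have h3 : ⌈Real.logb r m⌉ ≤ ((r ^ m - n - 1 : ℕ) : ℤ) := by omega
      have h4 : 0 ≤ ⌈Real.logb r m⌉ := Int.ceil_nonneg
        (Real.logb_nonneg (by exact_mod_cast (by omega : 1 < r)) (by exact_mod_cast hm))
      rw [OrientedIndex.ceil_logb_le_iff hm hr] at h3
      have h5 : m * r ≤ r ^ (r ^ m - n) := by
        rw [← Nat.sub_add_cancel (by omega : 1 ≤ r ^ m - n), pow_succ]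
        exact Nat.mul_le_mul_right r h3
      rw [if_pos ⟨he, OrientedIndex.asym_of_mul_le_pow hr he hm hmn h2 h5⟩]
    · rw [if_neg]
      rintro ⟨-, ha⟩
      have h3 := (OrientedIndex.ceil_logb_le_iff hm hr).2 ha.le_pow_compl
      omega
    · split_ifs
      · exact .inl rfl
      · exact .inr rfl
  · refine ⟨OrientedIndex.program, 40, fun m n r hmn hr h1 h2 h => ?_⟩
    have hm := hpos m n r h1 h2
    refine ⟨_, OrientedIndex.minOrientedIndex_completeBipartiteGraph hm hmn hr h1 h2,
      OrientedIndex.computesWithin_program hm hmn ?_ hr ?_ h2 ?_ (fun h => if_pos h)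
        (fun h => if_neg h)⟩
    · have : 1 ≤ (r - 1) ^ m := Nat.one_le_pow _ _ (by omega)
      omega
    · have : r - 1 ≤ (r - 1) ^ m := Nat.le_self_pow hm.ne' _
      omega
    -- On the boundary `r ^ m = n + ⌈log_r m⌉ ≤ n + m ≤ 2 * n`, which keeps the registers polynomial
    -- in `n`.
    · have h3 : ⌈Real.logb r m⌉ ≤ (m : ℤ) :=
        (OrientedIndex.ceil_logb_le_iff hm hr).2 (Nat.lt_pow_self (by omega)).le
      have h4 : ((r ^ m : ℕ) : ℤ) = (r : ℤ) ^ m := Nat.cast_pow _ _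
      omega
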